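/- **Theorem 2.** Let $d\ge 1$ and let $\mathcal A : M_d(\mathbb C)\to M_d(\mathbb C)$ be a quantum channel, i.e. a completely positive, trace preserving linear map. For an integer $r\ge 2$ and a channel $\mathcal C$ on $M_k(\mathbb C)$ put $$\beta_r(\mathcal C)=\frac{1}{1-r}\log \mathbb E\,\mathrm{Tr}\bigl[\mathcal C(|\phi\rangle\langle\phi|)^r\bigr],$$ where $\phi$ is uniformly distributed on the unit sphere of $\mathbb C^k$ and $\log$ is the logarithm to base $2$, and let $$\beta_r^{\mathrm{reg}}(\mathcal A)=\liminf_{n\to\infty}\frac1n\,\beta_r(\mathcal A^{\otimes n}).$$ Let $\mathrm{Choi}(\mathcal A)=\sum_{x,y}\mathcal A(|x\rangle\langle y|)\otimes|x\rangle\langle y|$, where $|x\rangle$, $|y\rangle$ run over the standard basis of $\mathbb C^d$, let $\mathcal R(\alpha)$, $\alpha\in \mathrm{Sym}(r)$, be the operator on $(\mathbb C^d)^{\otimes r}$ with $\mathcal R(\alpha)(v_1\otimes\cdots\otimes v_r)=v_{\alpha(1)}\otimes\cdots\otimes v_{\alpha(r)}$, and let $$\mathcal Q_{\mathcal A,r}(\alpha)=\mathrm{Tr}\bigl[\mathrm{Choi}(\mathcal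 A)^{\otimes r}\,(\mathcal R(12\cdots r)\otimes\mathcal R(\alpha))\bigr],\qquad \mathcal Q_{\max}=\max_{\alpha\in \mathrm{Sym}(r)}|\mathcal Q_{\mathcal A,r}(\alpha)|,$$ where $\mathcal R(12\cdots r)$ acts on the $r$ output factors and $\mathcal R(\alpha)$ on the $r$ remaining factors of $(\mathbb C^d\otimes\mathbb C^d)^{\otimes r}$. (a) For every integer $r\ge2$, $$\beta_r^{\mathrm{reg}}(\mathcal A)=\frac{r\log d-\log \mathcal Q_{\max}}{r-1}.$$ (b) Let $r\ge 2$ be an integer. If the maximum $\mathcal Q_{\max}$ is attained for a unique $\alpha\in \mathrm{Sym}(r)$, then the limit of $\frac1n\beta_r(\mathcal A^{\otimes n})$ exists and $$\beta_r^{\mathrm{reg}}(\mathcal A)=\lim_{n\to\infty}\frac1n\,\beta_r(\mathcal A^{\otimes n}).$$ (c) If $\mathcal A$ is entrywise positive, i.e. there are orthonormal bases $(e_x)$ of the input space and $(f_s)$ of the output space such that $\langle f_s|\mathcal A(|e_x\rangle\langle e_y|)|f_t\rangle\ge0$ for all $x,y,s,t$, then for every integer $r\ge2$ the limit of $\frac1n\beta_r(\mathcal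 A^{\otimes n})$ exists and $$\beta_r^{\mathrm{reg}}(\mathcal A)=\lim_{n\to\infty}\frac1n\,\beta_r(\mathcal A^{\otimes n}).$$ -/

import Mathlib

open Filter Topology MeasureTheory
open scoped ComplexOrder Kronecker

/-! ### Quantum channels on matrix algebras -/

/-- The map `id_k ⊗ Φ` on `M_k(ℂ) ⊗ M_ι(ℂ)`: `Φ` is applied to each of the `k × k` blocks. -/
def ampliation {ι : Type*} (k : ℕ) (Φ : Matrix ι ι ℂ →ₗ[ℂ] Matrix ι ι ℂ)
    (M : Matrix (Fin k × ι) (Fin k × ι) ℂ) : Matrix (Fin k × ι) (Fin k × ι) ℂ :=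
  Matrix.of fun p q => Φ (Matrix.of fun x y => M (p.1, x) (q.1, y)) p.2 q.2

/-- A quantum channel: a completely positive, trace preserving linear map. -/
structure IsChannel {ι : Type*} [Fintype ι] (Φ : Matrix ι ι ℂ →ₗ[ℂ] Matrix ι ι ℂ) : Prop where
  completelyPositive : ∀ (k : ℕ) (M : Matrix (Fin k × ι) (Fin k × ι) ℂ),
    M.PosSemidef → (ampliation k Φ M).PosSemidef
  tracePreserving : ∀ X : Matrix ι ι ℂ, (Φ X).trace = X.trace

/-- The tensor product `M₁ ⊗ ⋯ ⊗ M_n` of matrices, on the product index set. -/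
def tensorMatrix {ι : Type*} {n : ℕ} (M : Fin n → Matrix ι ι ℂ) :
    Matrix (Fin n → ι) (Fin n → ι) ℂ :=
  Matrix.of fun s t => ∏ i, M i (s i) (t i)

/-- The tensor power `Φ^{⊗ n}`: the linear map that sends each product matrix unit
`|x₁⟩⟨y₁| ⊗ ⋯ ⊗ |x_n⟩⟨y_n|` to `Φ(|x₁⟩⟨y₁|) ⊗ ⋯ ⊗ Φ(|x_n⟩⟨y_n|)`. -/
def channelPow {ι : Type*} [Fintype ι] [DecidableEq ι]
    (Φ : Matrix ι ι ℂ →ₗ[ℂ] Matrix ι ι ℂ) (n : ℕ) :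
    Matrix (Fin n → ι) (Fin n → ι) ℂ →ₗ[ℂ] Matrix (Fin n → ι) (Fin n → ι) ℂ where
  toFun X := ∑ x : Fin n → ι, ∑ y : Fin n → ι,
    X x y • tensorMatrix fun i => Φ (Matrix.single (x i) (y i) 1)
  map_add' X Y := by simp [add_smul, Finset.sum_add_distrib]
  map_smul' c X := by simp [mul_smul, Finset.smul_sum]

/-! ### Average output moments -/

/-- The uniform probability measure on the unit vectors of `ℂ^ι`: the normalized surface
measure of the unit sphere. -/
noncomputable def uniformSphere (ι : Type*) [Fintype ι] :
    Measure (Metric.sphere (0 : EuclideanSpace ℂ ι) 1) :=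
  ((volume : Measure (EuclideanSpace ℂ ι)).toSphere Set.univ)⁻¹ •
    (volume : Measure (EuclideanSpace ℂ ι)).toSphere

/-- The rank one operator `|u⟩⟨v|`. -/
def ketBra {ι : Type*} (u v : EuclideanSpace ℂ ι) : Matrix ι ι ℂ :=
  Matrix.of fun s t => u s * star (v t)

/-- The average output moment `𝔼 Tr Φ(|φ⟩⟨φ|)^r` over uniformly random unit vectors `φ`. -/
noncomputable def avgMoment {ι : Type*} [Fintype ι] [DecidableEq ι] (r : ℕ)
    (Φ : Matrix ι ι ℂ →ₗ[ℂ] Matrix ι ι ℂ) : ℝ :=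
  ∫ φ : Metric.sphere (0 : EuclideanSpace ℂ ι) 1,
    ((Φ (ketBra φ.1 φ.1) ^ r).trace).re ∂(uniformSphere ι)

/-- `β_r(Φ) = (1 - r)⁻¹ log 𝔼 Tr Φ(|φ⟩⟨φ|)^r`, with the logarithm to base two. -/
noncomputable def beta {ι : Type*} [Fintype ι] [DecidableEq ι] (r : ℕ)
    (Φ : Matrix ι ι ℂ →ₗ[ℂ] Matrix ι ι ℂ) : ℝ :=
  1 / (1 - (r : ℝ)) * Real.logb 2 (avgMoment r Φ)

/-- The sequence `n ↦ (1/n) β_r(Φ^{⊗ n})`. -/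
noncomputable def betaSeq {ι : Type*} [Fintype ι] [DecidableEq ι] (r : ℕ)
    (Φ : Matrix ι ι ℂ →ₗ[ℂ] Matrix ι ι ℂ) (n : ℕ) : ℝ :=
  1 / (n : ℝ) * beta r (channelPow Φ n)

/-- The regularized quantity `β_r^reg(Φ) = liminf_n (1/n) β_r(Φ^{⊗ n})`, an extended real. -/
noncomputable def betaReg {ι : Type*} [Fintype ι] [DecidableEq ι] (r : ℕ)
    (Φ : Matrix ι ι ℂ →ₗ[ℂ] Matrix ι ι ℂ) : EReal :=
  liminf (fun n : ℕ => (betaSeq r Φ n : EReal)) atTop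

/-! ### The quantities `Q(α)` -/

/-- The Choi-Jamiolkowski matrix `∑_{x,y} Φ(|x⟩⟨y|) ⊗ |x⟩⟨y|`. -/
def choi {ι : Type*} [Fintype ι] [DecidableEq ι]
    (Φ : Matrix ι ι ℂ →ₗ[ℂ] Matrix ι ι ℂ) : Matrix (ι × ι) (ι × ι) ℂ :=
  ∑ x : ι, ∑ y : ι, Φ (Matrix.single x y 1) ⊗ₖ Matrix.single x y (1 : ℂ)

/-- The permutation operator `v₁ ⊗ ⋯ ⊗ v_r ↦ v_{α(1)} ⊗ ⋯ ⊗ v_{α(r)}` on `(ℂ^ι)^{⊗ r}`: the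
basis vector with index `x` is sent to the basis vector with index `x ∘ α`. -/
def permOp (ι : Type*) [DecidableEq ι] {r : ℕ} (α : Equiv.Perm (Fin r)) :
    Matrix (Fin r → ι) (Fin r → ι) ℂ :=
  Matrix.of fun y x => if y = x ∘ α then 1 else 0

/-- `Q_{Φ,r}(α) = Tr [Choi(Φ)^{⊗ r} (R(12…r) ⊗ R(α))]`, where `(ℂ^ι ⊗ ℂ^ι)^{⊗ r}` is identified
with `(ℂ^ι)^{⊗ r} ⊗ (ℂ^ι)^{⊗ r}`; the first factor collects the `r` output spaces. The
permutation `finRotate r` is the cycle `i ↦ i + 1` modulo `r`. -/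
def permMoment {ι : Type*} [Fintype ι] [DecidableEq ι] {r : ℕ}
    (Φ : Matrix ι ι ℂ →ₗ[ℂ] Matrix ι ι ℂ) (α : Equiv.Perm (Fin r)) : ℂ :=
  ((tensorMatrix fun _ : Fin r => choi Φ).reindex
      (Equiv.arrowProdEquivProdArrow (Fin r) (fun _ => ι) (fun _ => ι))
      (Equiv.arrowProdEquivProdArrow (Fin r) (fun _ => ι) (fun _ => ι)) *
    (permOp ι (finRotate r) ⊗ₖ permOp ι α)).trace

/-- `Q_max = max_{α ∈ Sym(r)} |Q_{Φ,r}(α)|`. -/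
noncomputable def permMomentMax {ι : Type*} [Fintype ι] [DecidableEq ι] (r : ℕ)
    (Φ : Matrix ι ι ℂ →ₗ[ℂ] Matrix ι ι ℂ) : ℝ :=
  Finset.univ.sup' Finset.univ_nonempty fun α : Equiv.Perm (Fin r) => ‖permMoment Φ α‖

/-- `Φ` is entrywise positive: for some orthonormal bases `e` of the input space and `f` of the
output space, all the numbers `⟨f_s| Φ(|e_x⟩⟨e_y|) |f_t⟩` are real and nonnegative. -/
def EntrywisePositive {ι : Type*} [Fintype ι] (Φ : Matrix ι ι ℂ →ₗ[ℂ] Matrix ι ι ℂ) : Prop :=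
  ∃ e f : OrthonormalBasis ι ℂ (EuclideanSpace ℂ ι), ∀ x y s t : ι,
    0 ≤ ∑ a : ι, ∑ b : ι, star (f s a) * Φ (ketBra (e x) (e y)) a b * f t b

/-! ### Gaussian and spherical moments -/

/-! Expand `Tr Φ(|φ⟩⟨φ|)^r` around the cycle `finRotate r`: it is a sum of monomials `∏ φ(x i) conj
φ(y i)`. The spherical mean of such a monomial counts the permutations `α` with `y = x ∘ α`, divided
by the rising factorial of the dimension (`integral_uniformSphere_prod`). Hence the average moment
is `∑ α, permMoment Φ α` over that factorial (`integral_trace_pow_ketBra`).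

Tensor powers raise each `permMoment` to the power `n` (`permMoment_channelPow`), and the rising
factorial of `d ^ n` lies between `d ^ (n r)` and `r! d ^ (n r)`. What remains is the growth of `|∑
α, q α ^ n|` for finitely many complex `q α` of maximal modulus `Q`. It is at most `r! Q ^ n`. It is
at least `Q ^ n / 2` infinitely often, because the phases of the dominant terms return near `1`
together (`frequently_le_norm_sum_pow`); for all large `n` if one term dominates; for all `n` if
every `q α` is nonnegative. Since `1 / (1 - r) < 0`, moments large infinitely often give the liminf,
and moments eventually large give the limit. -/

lemma integral_monomial_mul_gaussian (a b : ℕ) :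
    ∫ z : ℂ, z ^ a * star z ^ b * (Real.exp (-‖z‖ ^ 2) : ℂ) =
      if a = b then (Real.pi : ℂ) * (a.factorial : ℂ) else 0 := by
  split_ifs with h
  · subst h
    have h1 : ∀ z : ℂ, z ^ a * star z ^ a * (Real.exp (-‖z‖ ^ 2) : ℂ) =
        ((‖z‖ ^ (2 * a : ℝ) * Real.exp (-‖z‖ ^ (2 : ℝ)) : ℝ) : ℂ) := by
      intro z
      rw [← mul_pow, ← starRingEnd_apply, Complex.mul_conj, Complex.normSq_eq_norm_sq]
      have : ‖z‖ ^ (2 * a : ℝ) = (‖z‖ ^ 2) ^ a := by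
        rw [← pow_mul, ← Real.rpow_natCast]; push_cast; rfl
      rw [this]
      push_cast
      norm_num
    simp_rw [h1]
    rw [integral_complex_ofReal, Complex.integral_rpow_mul_exp_neg_rpow (by norm_num)
      (by have : (0 : ℝ) ≤ a := a.cast_nonneg
          linarith)]
    have : ((2 * a + 2) / 2 : ℝ) = a + 1 := by ring
    rw [this, Real.Gamma_nat_eq_factorial]
    push_cast
    ring
  · have hne : (a : ℝ) - b ≠ 0 := sub_ne_zero.2 (by exact_mod_cast h)
    -- Rotation by this angle multiplies the integrand by `exp (iπ) = -1`, so the integral equals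
    -- its own negative.
    set u : Circle := Circle.exp (Real.pi / (a - b)) with hu
    have hu1 : (u : ℂ) ^ a * star (u : ℂ) ^ b = -1 := by
      have h2 : star (u : ℂ) = ((u⁻¹ : Circle) : ℂ) := by
        rw [Circle.coe_inv_eq_conj]; rfl
      rw [h2, hu, ← Circle.exp_neg, Circle.coe_exp, Circle.coe_exp, ← Complex.exp_nat_mul,
        ← Complex.exp_nat_mul, ← Complex.exp_add, ← Complex.exp_pi_mul_I]
      congr 1
      have hne' : (a : ℂ) - b ≠ 0 := by exact_mod_cast hne
      push_cast
      field_simp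
      ring
    have h3 := (rotation u).measurePreserving.integral_comp
      (rotation u).toHomeomorph.measurableEmbedding
      (fun z : ℂ => z ^ a * star z ^ b * (Real.exp (-‖z‖ ^ 2) : ℂ))
    have h4 : ∀ z : ℂ, (rotation u z) ^ a * star (rotation u z) ^ b *
        (Real.exp (-‖rotation u z‖ ^ 2) : ℂ) =
        -(z ^ a * star z ^ b * (Real.exp (-‖z‖ ^ 2) : ℂ)) := by
      intro z
      rw [LinearIsometryEquiv.norm_map, rotation_apply, star_mul', mul_pow, mul_pow]
      linear_combination (z ^ a * star z ^ b * (Real.exp (-‖z‖ ^ 2) : ℂ)) * hu1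
    simp_rw [h4] at h3
    rw [integral_neg] at h3
    exact self_eq_neg.1 h3.symm

/-- Polar coordinates separate the two factors; the Gamma value is the radial integral. Spherical
means can thus be read off from Gaussian ones. -/
lemma integral_homogeneous_mul_gaussian {E : Type*} [NormedAddCommGroup E] [NormedSpace ℝ E]
    [MeasurableSpace E] [BorelSpace E] [FiniteDimensional ℝ E] [Nontrivial E]
    (μ : Measure E) [μ.IsAddHaarMeasure] (f : E → ℂ) (m : ℕ)
    (hf : ∀ t : ℝ, 0 < t → ∀ z, f (t • z) = (t : ℂ) ^ m * f z) :
    ∫ z, f z * (Real.exp (-‖z‖ ^ 2) : ℂ) ∂μ =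
      (∫ φ : Metric.sphere (0 : E) 1, f φ ∂μ.toSphere) *
        ((Real.Gamma ((m + Module.finrank ℝ E : ℝ) / 2) / 2 : ℝ) : ℂ) := by
  set D := Module.finrank ℝ E with hD
  have hDpos : 0 < D := Module.finrank_pos
  have hrad : ∫ ρ : Set.Ioi (0 : ℝ), ((ρ.1 ^ m * Real.exp (-ρ.1 ^ 2) : ℝ) : ℂ)
      ∂(Measure.volumeIoiPow (D - 1)) =
        ((Real.Gamma ((m + D : ℝ) / 2) / 2 : ℝ) : ℂ) := by
    rw [integral_complex_ofReal]
    congr 1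
    simp only [Measure.volumeIoiPow, ENNReal.ofReal]
    rw [integral_withDensity_eq_integral_smul
        ((measurable_subtype_coe.pow_const _).real_toNNReal),
      integral_subtype_comap measurableSet_Ioi fun a : ℝ ↦
        Real.toNNReal (a ^ (D - 1)) • (a ^ m * Real.exp (-a ^ 2)),
      setIntegral_congr_fun (g := fun a : ℝ => a ^ ((m + D : ℝ) - 1) * Real.exp (-a ^ (2 : ℝ)))
        measurableSet_Ioi fun x hx ↦ ?_]
    · rw [integral_rpow_mul_exp_neg_rpow (by norm_num)
        (by have h1 : (1 : ℝ) ≤ D := by exact_mod_cast hDpos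
            have h2 : (0 : ℝ) ≤ m := m.cast_nonneg
            linarith)]
      rw [sub_add_cancel]
      ring
    · have hx' : (0 : ℝ) < x := hx
      have : x ^ ((m + D : ℝ) - 1) = x ^ (D - 1) * x ^ m := by
        rw [← pow_add, ← Real.rpow_natCast]
        congr 1
        push_cast [Nat.cast_pred hDpos]
        ring
      simp only
      rw [NNReal.smul_def, Real.coe_toNNReal _ (pow_nonneg hx'.le _), this, smul_eq_mul]
      norm_num
      ring
  calc
    _ = ∫ x : ({(0)}ᶜ : Set E), f x.1 * (Real.exp (-‖x.1‖ ^ 2) : ℂ) ∂(μ.comap (↑)) := by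
      rw [integral_subtype_comap (measurableSet_singleton _).compl
        fun x ↦ f x * (Real.exp (-‖x‖ ^ 2) : ℂ), restrict_compl_singleton]
    _ = ∫ x, f x.1 * ((x.2.1 ^ m * Real.exp (-x.2.1 ^ 2) : ℝ) : ℂ)
          ∂μ.toSphere.prod (.volumeIoiPow (D - 1)) := by
      rw [← μ.measurePreserving_homeomorphUnitSphereProd.integral_comp
        (Homeomorph.measurableEmbedding _)]
      refine integral_congr_ae (Eventually.of_forall fun x => ?_)
      have hx : 0 < ‖x.1‖ := norm_pos_iff.2 x.2
      have h1 := hf ‖x.1‖ hx (‖x.1‖⁻¹ • x.1)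
      rw [smul_inv_smul₀ hx.ne'] at h1
      simp only [homeomorphUnitSphereProd_apply_snd_coe, homeomorphUnitSphereProd_apply_fst_coe]
      rw [h1]
      push_cast
      ring
    _ = _ := by
      rw [integral_prod_mul (fun φ : Metric.sphere (0 : E) 1 => f φ)
        (fun ρ : Set.Ioi (0 : ℝ) => ((ρ.1 ^ m * Real.exp (-ρ.1 ^ 2) : ℝ) : ℂ)), hrad]

/-- By uniqueness of Haar measure, `volume` is a multiple of the product measure, over which the
integral factorizes. The value of `c` is irrelevant: it cancels on normalizing. -/
lemma exists_integral_gaussian_pi (ι : Type*) [Fintype ι] :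
    ∃ c : ℝ, c ≠ 0 ∧ ∀ a b : ι → ℕ,
      ∫ z : EuclideanSpace ℂ ι, (∏ j, (z j ^ a j * star (z j) ^ b j)) *
        (Real.exp (-‖z‖ ^ 2) : ℂ) =
      c * ∏ j, if a j = b j then (Real.pi : ℂ) * ((a j).factorial : ℂ) else 0 := by
  let e : EuclideanSpace ℂ ι ≃L[ℝ] (ι → ℂ) := PiLp.continuousLinearEquiv 2 ℝ (fun _ : ι => ℂ)
  let ν : Measure (ι → ℂ) := Measure.map e (volume : Measure (EuclideanSpace ℂ ι))
  have hν : ν.IsAddHaarMeasure := e.isAddHaarMeasure_map volume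
  obtain ⟨c, hc⟩ : ∃ c : NNReal, ν = c • (volume : Measure (ι → ℂ)) :=
    ⟨_, Measure.isAddLeftInvariant_eq_smul ν (volume : Measure (ι → ℂ))⟩
  refine ⟨c, ?_, fun a b => ?_⟩
  · intro h0
    rw [NNReal.coe_eq_zero] at h0
    rw [h0, zero_smul] at hc
    exact hν.toIsOpenPosMeasure.open_pos Set.univ isOpen_univ Set.univ_nonempty (by rw [hc]; rfl)
  · let F : (ι → ℂ) → ℂ := fun z =>
      ∏ j, (z j ^ a j * star (z j) ^ b j * (Real.exp (-‖z j‖ ^ 2) : ℂ))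
    have h1 : ∀ z : EuclideanSpace ℂ ι, (∏ j, (z j ^ a j * star (z j) ^ b j)) *
        (Real.exp (-‖z‖ ^ 2) : ℂ) = F (e z) := by
      intro z
      simp only [F]
      rw [Finset.prod_mul_distrib (g := fun j => (Real.exp (-‖(e z) j‖ ^ 2) : ℂ)),
        EuclideanSpace.norm_sq_eq, ← Finset.sum_neg_distrib, Real.exp_sum]
      push_cast
      rfl
    have h2 : ∫ z : EuclideanSpace ℂ ι, F (e z) = ∫ w, F w ∂ν :=
      (e.toHomeomorph.measurableEmbedding.integral_map F).symm
    simp_rw [h1]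
    rw [h2, hc, integral_smul_nnreal_measure, NNReal.smul_def, Complex.real_smul]
    congr 1
    rw [integral_fintype_prod_volume_eq_prod (𝕜 := ℂ)
      (fun j (z : ℂ) => z ^ a j * star z ^ b j * (Real.exp (-‖z‖ ^ 2) : ℂ))]
    exact Finset.prod_congr rfl fun j _ => integral_monomial_mul_gaussian _ _

/-- A solution forces equal fibre sizes; given one solution, the others form a coset of the
stabilizer of `x`. The product has the shape of the Gaussian moments. -/
lemma card_perm_comp_eq {ι κ : Type*} [Fintype ι] [DecidableEq ι] [Fintype κ] [DecidableEq κ]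
    (x y : κ → ι) :
    Fintype.card {α : Equiv.Perm κ // y = x ∘ α} =
      ∏ j, if Fintype.card {i // x i = j} = Fintype.card {i // y i = j} then
        (Fintype.card {i // x i = j}).factorial else 0 := by
  by_cases h : ∀ j, Fintype.card {i // x i = j} = Fintype.card {i // y i = j}
  · let β : Equiv.Perm κ := Equiv.ofFiberEquiv fun j => (Fintype.equivOfCardEq (h j)).symm
    have hβ : x ∘ β = y := funext fun i => Equiv.ofFiberEquiv_map _ i
    rw [Finset.prod_congr rfl fun j _ => if_pos (h j), ← DomMulAct.stabilizer_card x]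
    refine Fintype.card_congr ((Equiv.mulRight β⁻¹).subtypeEquiv fun α => ?_)
    rw [← hβ, Equiv.coe_mulRight, Equiv.Perm.coe_mul]
    constructor
    · intro h
      rw [← Function.comp_assoc, ← h, Function.comp_assoc]
      ext i
      simp
    · intro h
      conv_lhs => rw [← h]
      ext i
      simp
  · push Not at h
    obtain ⟨j, hj⟩ := h
    rw [Finset.prod_eq_zero (Finset.mem_univ j) (if_neg hj), Fintype.card_eq_zero_iff]
    refine ⟨fun α => hj ?_⟩
    refine (Fintype.card_congr (α.1.subtypeEquiv fun i => ?_)).symm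
    rw [show y i = x (α.1 i) from congrFun α.2 i]

lemma integrable_uniformSphere_of_continuous {ι : Type*} [Fintype ι] [Nonempty ι]
    {f : Metric.sphere (0 : EuclideanSpace ℂ ι) 1 → ℂ} (hf : Continuous f) :
    Integrable f (uniformSphere ι) := by
  have h : Integrable f (volume : Measure (EuclideanSpace ℂ ι)).toSphere :=
    integrableOn_univ.1 (hf.continuousOn.integrableOn_compact isCompact_univ)
  refine h.smul_measure ?_
  rw [Ne, ENNReal.inv_eq_top, Measure.measure_univ_eq_zero]
  exact Measure.toSphere_ne_zero _

lemma integral_uniformSphere_prod {ι : Type*} [Fintype ι] [DecidableEq ι] [Nonempty ι] {r : ℕ}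
    (x y : Fin r → ι) :
    ∫ φ, ∏ i, (φ.1 (x i) * star (φ.1 (y i))) ∂(uniformSphere ι) =
      (Fintype.card {α : Equiv.Perm (Fin r) // y = x ∘ α} : ℂ) /
        ((Fintype.card ι).ascFactorial r : ℂ) := by
  obtain ⟨c, hc, H⟩ := exists_integral_gaussian_pi ι
  set N := Fintype.card ι with hN
  have hNpos : 0 < N := Fintype.card_pos
  have hdim : Module.finrank ℝ (EuclideanSpace ℂ ι) = 2 * N := by
    rw [finrank_real_of_complex, finrank_euclideanSpace]
  set σ := (volume : Measure (EuclideanSpace ℂ ι)).toSphere with hσ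
  have hprod : ∀ z : EuclideanSpace ℂ ι, ∏ i, (z (x i) * star (z (y i))) =
      ∏ j, (z j ^ Fintype.card {i // x i = j} * star (z j) ^ Fintype.card {i // y i = j}) := by
    intro z
    rw [Finset.prod_mul_distrib, Finset.prod_mul_distrib, ← Fintype.prod_fiberwise' x fun j => z j,
      ← Fintype.prod_fiberwise' y fun j => star (z j)]
    simp
  have h1 := integral_homogeneous_mul_gaussian (volume : Measure (EuclideanSpace ℂ ι))
    (fun z => ∏ i, (z (x i) * star (z (y i)))) (2 * r) (by
      intro t _ z
      have : ∀ i, (t • z) (x i) * star ((t • z) (y i)) =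
          (t : ℂ) ^ 2 * (z (x i) * star (z (y i))) := by
        intro i
        simp
        ring
      simp_rw [this]
      rw [Finset.prod_mul_distrib]
      simp [pow_mul])
  have h0 := integral_homogeneous_mul_gaussian (volume : Measure (EuclideanSpace ℂ ι))
    (fun _ => 1) 0 (by simp)
  have H0 := H (fun _ => 0) (fun _ => 0)
  have H1 := H (fun j => Fintype.card {i // x i = j}) (fun j => Fintype.card {i // y i = j})
  simp only [pow_zero, mul_one, Finset.prod_const_one, if_true, Nat.factorial_zero, Nat.cast_one,
    Finset.prod_const, Finset.card_univ] at H0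
  rw [H0, hdim] at h0
  simp_rw [← hprod] at H1
  rw [H1, hdim] at h1
  rw [card_perm_comp_eq]
  set P : ℕ := ∏ j, if Fintype.card {i // x i = j} = Fintype.card {i // y i = j} then
        (Fintype.card {i // x i = j}).factorial else 0 with hP
  have hPP : (∏ j, if Fintype.card {i // x i = j} = Fintype.card {i // y i = j} then
        (Real.pi : ℂ) * ((Fintype.card {i // x i = j}).factorial : ℂ) else 0) =
      (Real.pi : ℂ) ^ N * P := by
    rw [hP, hN, ← Finset.card_univ, ← Finset.prod_const]
    push_cast
    rw [← Finset.prod_mul_distrib]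
    refine Finset.prod_congr rfl fun j _ => ?_
    split_ifs <;> simp
  rw [hPP] at h1
  have hΓ1 : Real.Gamma (((2 * r : ℕ) + (2 * N : ℕ) : ℝ) / 2) =
      (N - 1).factorial * N.ascFactorial r := by
    rw [← Nat.cast_mul, Nat.factorial_mul_ascFactorial' N r hNpos, ← Real.Gamma_nat_eq_factorial]
    congr 1
    push_cast [Nat.cast_sub (show 1 ≤ N + r by lia)]
    ring
  have hΓ0 : Real.Gamma (((0 : ℕ) + (2 * N : ℕ) : ℝ) / 2) = (N - 1).factorial := by
    rw [← Real.Gamma_nat_eq_factorial]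
    congr 1
    push_cast [Nat.cast_sub (show 1 ≤ N by lia)]
    ring
  rw [hΓ0] at h0
  rw [hΓ1] at h1
  rw [uniformSphere, integral_smul_measure, ENNReal.toReal_inv, Complex.real_smul]
  change c * (Real.pi : ℂ) ^ N = (∫ φ : Metric.sphere (0 : EuclideanSpace ℂ ι) 1, (1 : ℂ) ∂σ) * _
    at h0
  rw [integral_const, Complex.real_smul, mul_one] at h0
  have hf : ((N - 1).factorial : ℂ) ≠ 0 := by exact_mod_cast Nat.factorial_ne_zero _
  have ha : (N.ascFactorial r : ℂ) ≠ 0 := by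
    have := Nat.ascFactorial_pos (N - 1) r
    rw [Nat.sub_add_cancel hNpos] at this
    exact_mod_cast this.ne'
  have hpi : (Real.pi : ℂ) ≠ 0 := by exact_mod_cast Real.pi_ne_zero
  have hcc : (c : ℂ) ≠ 0 := by exact_mod_cast hc
  have hS : ((σ.real Set.univ : ℝ) : ℂ) ≠ 0 := by
    intro h
    rw [h, zero_mul] at h0
    exact mul_ne_zero hcc (pow_ne_zero _ hpi) h0
  change ((((σ.real Set.univ)⁻¹ : ℝ)) : ℂ) * (∫ φ, _ ∂σ) = _
  rw [Complex.ofReal_inv]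
  set I := ∫ φ : Metric.sphere (0 : EuclideanSpace ℂ ι) 1, ∏ i, (φ.1 (x i) * star (φ.1 (y i))) ∂σ
  push_cast at h0 h1
  rw [eq_div_iff ha, inv_mul_eq_div, div_mul_eq_mul_div, div_eq_iff hS]
  -- Eliminates `c * π ^ N` between the Gaussian integrals of the monomial and of `1`.
  have h2 : (N - 1).factorial * (I * (N.ascFactorial r : ℂ)) =
      (N - 1).factorial * (P * (σ.real Set.univ : ℂ)) := by
    linear_combination (-2) * h1 + 2 * P * h0
  exact mul_left_cancel₀ hf h2

/-! ### Traces of powers and permutation moments -/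

lemma prod_sum_sum_eq {κ ι R : Type*} [Fintype κ] [Fintype ι] [DecidableEq κ] [CommSemiring R]
    (g : κ → ι → ι → R) :
    ∏ i, ∑ a, ∑ b, g i a b = ∑ x : κ → ι, ∑ y : κ → ι, ∏ i, g i (x i) (y i) := by
  rw [Finset.prod_univ_sum, Fintype.piFinset_univ]
  refine Finset.sum_congr rfl fun x _ => ?_
  rw [Finset.prod_univ_sum, Fintype.piFinset_univ]

lemma Matrix.pow_succ_apply_eq_sum_paths {ι R : Type*} [Fintype ι] [DecidableEq ι]
    [CommSemiring R] (M : Matrix ι ι R) (n : ℕ) (a b : ι) :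
    (M ^ (n + 1)) a b = ∑ s : Fin n → ι, ∏ i : Fin (n + 1),
      M ((Fin.cons a s : Fin (n + 1) → ι) i) ((Fin.snoc s b : Fin (n + 1) → ι) i) := by
  induction n generalizing a with
  | zero => simp [Fin.snoc]
  | succ n ih =>
    rw [pow_succ', Matrix.mul_apply, ← (Fin.consEquiv fun _ => ι).sum_comp, Fintype.sum_prod_type]
    refine Finset.sum_congr rfl fun c _ => ?_
    rw [ih, Finset.mul_sum]
    refine Finset.sum_congr rfl fun s _ => ?_
    rw [Fin.prod_univ_succ (n := n + 1)]
    change _ = M a ((Fin.snoc (Fin.cons c s : Fin (n + 1) → ι) b : Fin (n + 2) → ι) 0) *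
      ∏ i : Fin (n + 1), M ((Fin.cons c s : Fin (n + 1) → ι) i)
        ((Fin.snoc (Fin.cons c s : Fin (n + 1) → ι) b : Fin (n + 2) → ι) i.succ)
    rw [← Fin.cons_snoc_eq_snoc_cons]
    simp

/-- The trace closes the paths of length `r` into cycles. For `r = 0` the sides would be `card ι`
and `1`. -/
lemma Matrix.trace_pow_eq_sum_cycles {ι R : Type*} [Fintype ι] [DecidableEq ι]
    [CommSemiring R] (M : Matrix ι ι R) {r : ℕ} (hr : r ≠ 0) :
    (M ^ r).trace = ∑ s : Fin r → ι, ∏ i, M (s i) (s (finRotate r i)) := by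
  obtain ⟨n, rfl⟩ := Nat.exists_eq_succ_of_ne_zero hr
  rw [← (Fin.consEquiv fun _ => ι).sum_comp, Fintype.sum_prod_type, Matrix.trace]
  refine Finset.sum_congr rfl fun a _ => ?_
  rw [Matrix.diag_apply, Matrix.pow_succ_apply_eq_sum_paths]
  refine Finset.sum_congr rfl fun s _ => Finset.prod_congr rfl fun i _ => ?_
  congr 1
  refine Fin.lastCases ?_ (fun j => ?_) i
  · simp [Fin.consEquiv]
  · simp [Fin.consEquiv]

section Channels

variable {ι : Type*} [Fintype ι] [DecidableEq ι]

lemma apply_eq_sum_single (Φ : Matrix ι ι ℂ →ₗ[ℂ] Matrix ι ι ℂ) (X : Matrix ι ι ℂ) (s t : ι) :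
    Φ X s t = ∑ x, ∑ y, X x y * Φ (Matrix.single x y 1) s t := by
  conv_lhs => rw [Matrix.matrix_eq_sum_single X]
  simp only [map_sum, Matrix.sum_apply]
  refine Finset.sum_congr rfl fun x _ => Finset.sum_congr rfl fun y _ => ?_
  rw [← mul_one (X x y), ← smul_eq_mul, ← Matrix.smul_single, map_smul, Matrix.smul_apply,
    smul_eq_mul, smul_eq_mul, mul_one]

lemma choi_apply (Φ : Matrix ι ι ℂ →ₗ[ℂ] Matrix ι ι ℂ) (p q : ι × ι) :
    choi Φ p q = Φ (Matrix.single p.2 q.2 1) p.1 q.1 := by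
  simp only [choi, Matrix.sum_apply, Matrix.kroneckerMap_apply, Matrix.single_apply]
  rw [Finset.sum_eq_single p.2 (fun b _ hb => by simp [hb]) (by simp),
    Finset.sum_eq_single q.2 (fun b _ hb => by simp [hb]) (by simp)]
  simp

lemma permMoment_eq_sum {r : ℕ} (Φ : Matrix ι ι ℂ →ₗ[ℂ] Matrix ι ι ℂ)
    (α : Equiv.Perm (Fin r)) :
    permMoment Φ α = ∑ s : Fin r → ι, ∑ x : Fin r → ι,
      ∏ i, Φ (Matrix.single (x i) (x (α i)) 1) (s i) (s (finRotate r i)) := by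
  rw [permMoment, Matrix.trace, Fintype.sum_prod_type]
  refine Finset.sum_congr rfl fun s _ => Finset.sum_congr rfl fun x _ => ?_
  rw [Matrix.diag_apply, Matrix.mul_apply,
    Finset.sum_eq_single (s ∘ finRotate r, x ∘ α) (fun b _ hb => ?_) (by simp)]
  · simp [permOp, Matrix.kroneckerMap_apply, tensorMatrix, choi_apply,
      Equiv.arrowProdEquivProdArrow]
  · have : ¬(b.1 = s ∘ finRotate r ∧ b.2 = x ∘ α) := fun h => hb (Prod.ext h.1 h.2)
    simp only [permOp, Matrix.kroneckerMap_apply, Matrix.of_apply]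
    split_ifs with h1 h2
    · exact absurd ⟨h1, h2⟩ this
    all_goals simp

lemma trace_pow_ketBra (Φ : Matrix ι ι ℂ →ₗ[ℂ] Matrix ι ι ℂ) {r : ℕ} (hr : r ≠ 0)
    (φ : EuclideanSpace ℂ ι) :
    (Φ (ketBra φ φ) ^ r).trace = ∑ s : Fin r → ι, ∑ x : Fin r → ι, ∑ y : Fin r → ι,
      (∏ i, (φ (x i) * star (φ (y i)))) *
        ∏ i, Φ (Matrix.single (x i) (y i) 1) (s i) (s (finRotate r i)) := by
  rw [Matrix.trace_pow_eq_sum_cycles _ hr]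
  refine Finset.sum_congr rfl fun s _ => ?_
  simp_rw [apply_eq_sum_single Φ (ketBra φ φ)]
  rw [prod_sum_sum_eq]
  simp_rw [Finset.prod_mul_distrib]
  simp [ketBra, Finset.prod_mul_distrib]

lemma continuous_trace_pow_ketBra (Φ : Matrix ι ι ℂ →ₗ[ℂ] Matrix ι ι ℂ) {r : ℕ} (hr : r ≠ 0) :
    Continuous fun φ : Metric.sphere (0 : EuclideanSpace ℂ ι) 1 =>
      (Φ (ketBra φ.1 φ.1) ^ r).trace := by
  simp_rw [trace_pow_ketBra Φ hr]
  fun_prop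

lemma integral_trace_pow_ketBra [Nonempty ι] (Φ : Matrix ι ι ℂ →ₗ[ℂ] Matrix ι ι ℂ) {r : ℕ}
    (hr : r ≠ 0) :
    ∫ φ, (Φ (ketBra φ.1 φ.1) ^ r).trace ∂(uniformSphere ι) =
      (∑ α : Equiv.Perm (Fin r), permMoment Φ α) / ((Fintype.card ι).ascFactorial r : ℂ) := by
  have hint : ∀ (x y : Fin r → ι) (c : ℂ), Integrable
      (fun φ : Metric.sphere (0 : EuclideanSpace ℂ ι) 1 =>
        (∏ i, (φ.1 (x i) * star (φ.1 (y i)))) * c) (uniformSphere ι) := fun x y c =>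
    integrable_uniformSphere_of_continuous (by fun_prop)
  simp_rw [trace_pow_ketBra Φ hr]
  rw [integral_finsetSum _ fun s _ => integrable_finsetSum _ fun x _ =>
    integrable_finsetSum _ fun y _ => hint _ _ _]
  simp_rw [permMoment_eq_sum]
  rw [Finset.sum_comm, Finset.sum_div]
  refine Finset.sum_congr rfl fun s _ => ?_
  rw [integral_finsetSum _ fun x _ => integrable_finsetSum _ fun y _ => hint _ _ _,
    Finset.sum_comm, Finset.sum_div]
  refine Finset.sum_congr rfl fun x _ => ?_
  rw [integral_finsetSum _ fun y _ => hint _ _ _]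
  simp_rw [integral_mul_const, integral_uniformSphere_prod, div_mul_eq_mul_div]
  rw [← Finset.sum_div]
  congr 1
  -- Grouping the `α` by `y = x ∘ α` produces the multiplicities given by the spherical mean.
  rw [← Finset.sum_fiberwise Finset.univ fun α : Equiv.Perm (Fin r) => x ∘ α]
  refine Finset.sum_congr rfl fun y _ => ?_
  rw [Finset.sum_congr rfl (g := fun _ =>
    ∏ i, Φ (Matrix.single (x i) (y i) 1) (s i) (s (finRotate r i)))]
  · rw [Finset.sum_const, nsmul_eq_mul, Fintype.card_subtype]
    simp_rw [eq_comm]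
  · intro α hα
    rw [← (Finset.mem_filter.1 hα).2]
    rfl

/-! ### Tensor powers of channels -/

lemma channelPow_single (Φ : Matrix ι ι ℂ →ₗ[ℂ] Matrix ι ι ℂ) (n : ℕ) (x y s t : Fin n → ι) :
    channelPow Φ n (Matrix.single x y 1) s t =
      ∏ j, Φ (Matrix.single (x j) (y j) 1) (s j) (t j) := by
  simp only [channelPow, LinearMap.coe_mk, AddHom.coe_mk, Matrix.sum_apply, Matrix.smul_apply,
    Matrix.single_apply, tensorMatrix, Matrix.of_apply]
  rw [Finset.sum_eq_single x (fun b _ hb => by simp [hb.symm]) (by simp),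
    Finset.sum_eq_single y (fun b _ hb => by simp [hb.symm]) (by simp)]
  simp

/-- The same permutations act on every tensor leg, so transposing the indices `Fin r` and `Fin n`
factorizes the sum. -/
lemma permMoment_channelPow (Φ : Matrix ι ι ℂ →ₗ[ℂ] Matrix ι ι ℂ) (n : ℕ) {r : ℕ}
    (α : Equiv.Perm (Fin r)) :
    permMoment (channelPow Φ n) α = permMoment Φ α ^ n := by
  simp_rw [permMoment_eq_sum, channelPow_single]
  rw [← Fin.prod_const, prod_sum_sum_eq, ← (Equiv.piComm fun _ _ => ι).sum_comp]
  refine Finset.sum_congr rfl fun s _ => ?_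
  rw [← (Equiv.piComm fun _ _ => ι).sum_comp]
  refine Finset.sum_congr rfl fun x _ => ?_
  rw [Finset.prod_comm]
  rfl

lemma trace_channelPow (Φ : Matrix ι ι ℂ →ₗ[ℂ] Matrix ι ι ℂ)
    (hΦ : ∀ X : Matrix ι ι ℂ, (Φ X).trace = X.trace) (n : ℕ)
    (X : Matrix (Fin n → ι) (Fin n → ι) ℂ) : (channelPow Φ n X).trace = X.trace := by
  have h : ∀ x y : Fin n → ι, ∑ s : Fin n → ι, ∏ j, Φ (Matrix.single (x j) (y j) 1) (s j) (s j) =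
      if x = y then 1 else 0 := by
    intro x y
    have : ∀ j, ∑ a, Φ (Matrix.single (x j) (y j) 1) a a = if x j = y j then 1 else 0 := by
      intro j
      change (Φ (Matrix.single (x j) (y j) 1)).trace = _
      rw [hΦ]
      split_ifs with h
      · rw [h, Matrix.trace_single_eq_same]
      · exact Matrix.trace_single_eq_of_ne _ _ _ h
    have h1 := Finset.prod_univ_sum (fun _ : Fin n => (Finset.univ : Finset ι))
      (fun j a => Φ (Matrix.single (x j) (y j) 1) a a)
    rw [Fintype.piFinset_univ] at h1
    rw [← h1]
    simp_rw [this]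
    rw [Finset.prod_ite_zero]
    simp [funext_iff]
  simp_rw [Matrix.trace, Matrix.diag_apply]
  simp_rw [apply_eq_sum_single (channelPow Φ n) X, channelPow_single]
  rw [Finset.sum_comm]
  refine Finset.sum_congr rfl fun x _ => ?_
  rw [Finset.sum_comm]
  simp_rw [← Finset.mul_sum, h]
  simp

/-- A rank-one decomposition of the Choi matrix yields Kraus operators; the columns of `C` are their
`n`-fold tensor products applied to `φ`. -/
lemma posSemidef_channelPow_ketBra (Φ : Matrix ι ι ℂ →ₗ[ℂ] Matrix ι ι ℂ)
    (hΦ : (choi Φ).PosSemidef) (n : ℕ) (φ : EuclideanSpace ℂ (Fin n → ι)) :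
    (channelPow Φ n (ketBra φ φ)).PosSemidef := by
  obtain ⟨m, v, hv⟩ := Matrix.posSemidef_iff_eq_sum_vecMulVec.1 hΦ
  have hB : ∀ s t x y, Φ (Matrix.single x y 1) s t = ∑ w, v w (s, x) * star (v w (t, y)) := by
    intro s t x y
    have := congrFun (congrFun hv (s, x)) (t, y)
    rw [choi_apply] at this
    simpa [Matrix.sum_apply, Matrix.vecMulVec_apply] using this
  let C : Matrix (Fin n → ι) (Fin n → Fin m) ℂ :=
    Matrix.of fun s w => ∑ x : Fin n → ι, φ x * ∏ j, v (w j) (s j, x j)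
  have : channelPow Φ n (ketBra φ φ) = C * C.conjTranspose := by
    ext s t
    rw [apply_eq_sum_single, Matrix.mul_apply]
    simp_rw [C, Matrix.conjTranspose_apply, Matrix.of_apply, star_sum, Finset.sum_mul_sum]
    symm
    rw [Finset.sum_comm]
    refine Finset.sum_congr rfl fun x _ => ?_
    rw [Finset.sum_comm]
    refine Finset.sum_congr rfl fun y _ => ?_
    symm
    simp_rw [channelPow_single, hB]
    rw [Finset.prod_univ_sum, Fintype.piFinset_univ, Finset.mul_sum]
    refine Finset.sum_congr rfl fun w _ => ?_
    rw [Finset.prod_mul_distrib, star_mul', star_prod, ketBra, Matrix.of_apply]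
    ring
  rw [this]
  exact Matrix.posSemidef_self_mul_conjTranspose C

end Channels

/-! ### Positivity of the average moments -/

lemma IsChannel.posSemidef_choi {d : ℕ} {A : Matrix (Fin d) (Fin d) ℂ →ₗ[ℂ] Matrix (Fin d) (Fin d) ℂ}
    (hA : IsChannel A) : (choi A).PosSemidef := by
  -- The unnormalized maximally entangled vector. `ampliation` puts the reference factor first,
  -- `choi` second, hence the swap below.
  let v : Fin d × Fin d → ℂ := fun p => if p.1 = p.2 then 1 else 0
  have h := hA.completelyPositive d _ (Matrix.posSemidef_vecMulVec_self_star v)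
  have : choi A = (ampliation d A (Matrix.vecMulVec v (star v))).submatrix Prod.swap Prod.swap := by
    ext p q
    rw [choi_apply]
    simp only [Matrix.submatrix_apply, ampliation, Matrix.of_apply, Prod.fst_swap, Prod.snd_swap]
    have hM : Matrix.single p.2 q.2 (1 : ℂ) =
        Matrix.of fun x y => Matrix.vecMulVec v (star v) (p.2, x) (q.2, y) := by
      ext x y
      simp only [Matrix.single_apply, Matrix.of_apply, Matrix.vecMulVec_apply, v, Pi.star_apply]
      split_ifs <;> simp_all
    rw [hM]
  rw [this]
  exact h.submatrix _

/-- If the positive semidefinite `M ^ r` had trace zero it would vanish, and a nilpotent `M` has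
trace zero. -/
lemma Matrix.PosSemidef.trace_pow_pos {ι : Type*} [Fintype ι] [DecidableEq ι] {M : Matrix ι ι ℂ}
    (hM : M.PosSemidef) (h : M.trace ≠ 0) (r : ℕ) : 0 < (M ^ r).trace := by
  refine lt_of_le_of_ne (hM.pow r).trace_nonneg fun h0 => h ?_
  have := (hM.pow r).trace_eq_zero_iff.1 h0.symm
  exact (Matrix.isNilpotent_trace_of_isNilpotent ⟨r, this⟩).eq_zero

lemma ofReal_avgMoment_eq {ι : Type*} [Fintype ι] [DecidableEq ι] [Nonempty ι]
    (Φ : Matrix ι ι ℂ →ₗ[ℂ] Matrix ι ι ℂ)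
    (hΦ : ∀ φ : EuclideanSpace ℂ ι, (Φ (ketBra φ φ)).PosSemidef) {r : ℕ} (hr : r ≠ 0) :
    (avgMoment r Φ : ℂ) =
      (∑ α : Equiv.Perm (Fin r), permMoment Φ α) / ((Fintype.card ι).ascFactorial r : ℂ) := by
  rw [← integral_trace_pow_ketBra Φ hr, avgMoment, ← integral_complex_ofReal]
  refine integral_congr_ae (Eventually.of_forall fun φ => ?_)
  exact Complex.ext rfl (Complex.nonneg_iff.1 ((hΦ φ.1).pow r).trace_nonneg).2

lemma avgMoment_pos {ι : Type*} [Fintype ι] [DecidableEq ι] [Nonempty ι]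
    (Φ : Matrix ι ι ℂ →ₗ[ℂ] Matrix ι ι ℂ)
    (hΦ : ∀ φ : EuclideanSpace ℂ ι, (Φ (ketBra φ φ)).PosSemidef)
    (hTr : ∀ X, (Φ X).trace = X.trace) {r : ℕ} (hr : r ≠ 0) :
    0 < avgMoment r Φ := by
  have hpos : ∀ φ : Metric.sphere (0 : EuclideanSpace ℂ ι) 1,
      0 < ((Φ (ketBra φ.1 φ.1) ^ r).trace).re := by
    intro φ
    refine (Complex.pos_iff.1 ((hΦ φ.1).trace_pow_pos ?_ r)).1
    have h1 : ‖φ.1‖ = 1 := by simp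
    have h2 := EuclideanSpace.norm_sq_eq φ.1
    have h3 : (ketBra φ.1 φ.1).trace = ((∑ i, ‖φ.1 i‖ ^ 2 : ℝ) : ℂ) := by
      simp [Matrix.trace, ketBra, Complex.mul_conj, Complex.normSq_eq_norm_sq]
    rw [hTr, h3, ← h2, h1]
    simp
  rw [avgMoment, integral_pos_iff_support_of_nonneg (fun φ => (hpos φ).le)
    (integrable_uniformSphere_of_continuous (continuous_trace_pow_ketBra Φ hr)).re]
  rw [Function.support_eq_univ fun φ => (hpos φ).ne', pos_iff_ne_zero, uniformSphere,
    Measure.smul_apply, smul_eq_mul]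
  exact mul_ne_zero (ENNReal.inv_ne_zero.2 (measure_ne_top _ _))
    (Measure.measure_univ_eq_zero.not.2 (Measure.toSphere_ne_zero _))

/-! ### Entrywise positive channels -/

lemma OrthonormalBasis.sum_star_mul_eq {ι : Type*} [Fintype ι] [DecidableEq ι]
    (f : OrthonormalBasis ι ℂ (EuclideanSpace ℂ ι)) (a b : ι) :
    ∑ c, star (f c a) * f c b = if a = b then 1 else 0 := by
  let U : Matrix ι ι ℂ := Matrix.of fun c a => f c a
  have h : U * U.conjTranspose = 1 := by
    ext s t
    have := orthonormal_iff_ite.1 f.orthonormal t s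
    rw [PiLp.inner_apply] at this
    rw [Matrix.mul_apply, Matrix.one_apply]
    simpa [U, eq_comm] using this
  have h2 : (U.conjTranspose * U) a b = (1 : Matrix ι ι ℂ) a b := by rw [mul_eq_one_comm.1 h]
  rwa [Matrix.mul_apply, Matrix.one_apply] at h2

/-- Invariance under change of basis: each `s i` occurs once as a row index and once, through `π`,
as a column index, so orthonormality collapses its sum. -/
lemma sum_prod_conj_eq {ι κ : Type*} [Fintype ι] [DecidableEq ι] [Fintype κ] [DecidableEq κ]
    (U : ι → ι → ℂ) (hU : ∀ a b, ∑ c, star (U c a) * U c b = if a = b then 1 else 0)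
    (π : Equiv.Perm κ) (L : κ → ι → ι → ℂ) :
    ∑ s : κ → ι, ∏ i, ∑ a, ∑ b, star (U (s i) a) * L i a b * U (s (π i)) b =
      ∑ s : κ → ι, ∏ i, L i (s i) (s (π i)) := by
  simp_rw [prod_sum_sum_eq]
  rw [Finset.sum_comm]
  refine Finset.sum_congr rfl fun a _ => ?_
  rw [Finset.sum_comm]
  have h1 : ∀ b : κ → ι,
      ∑ s : κ → ι, ∏ i, (star (U (s i) (a i)) * L i (a i) (b i) * U (s (π i)) (b i)) =
        (∏ i, L i (a i) (b i)) * if b = a ∘ π then 1 else 0 := by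
    intro b
    have h2 : ∀ s : κ → ι,
        ∏ i, (star (U (s i) (a i)) * L i (a i) (b i) * U (s (π i)) (b i)) =
          (∏ i, L i (a i) (b i)) * ∏ i, (star (U (s i) (a i)) * U (s i) (b (π.symm i))) := by
      intro s
      have h3 : ∏ i, U (s (π i)) (b i) = ∏ i, U (s i) (b (π.symm i)) := by
        rw [← Equiv.prod_comp π fun i => U (s i) (b (π.symm i))]
        simp
      simp only [Finset.prod_mul_distrib]
      rw [h3]
      ring
    simp_rw [h2]
    rw [← Finset.mul_sum]
    congr 1
    have h4 := Finset.prod_univ_sum (fun _ : κ => (Finset.univ : Finset ι))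
      (fun i c => star (U c (a i)) * U c (b (π.symm i)))
    rw [Fintype.piFinset_univ] at h4
    rw [← h4]
    simp_rw [hU]
    rw [Finset.prod_ite_zero]
    simp only [Finset.mem_univ, true_imp_iff, Finset.prod_const_one]
    congr 1
    rw [eq_iff_iff, funext_iff]
    constructor
    · intro h i
      rw [Function.comp_apply, h (π i), Equiv.symm_apply_apply]
    · intro h i
      rw [h, Function.comp_apply, Equiv.apply_symm_apply]
  simp_rw [h1]
  simp

/-- Written in the bases `e` and `f`, every term of the sum is a product of nonnegative numbers. -/
lemma EntrywisePositive.permMoment_nonneg {ι : Type*} [Fintype ι] [DecidableEq ι]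
    {Φ : Matrix ι ι ℂ →ₗ[ℂ] Matrix ι ι ℂ} (hΦ : EntrywisePositive Φ) {r : ℕ}
    (α : Equiv.Perm (Fin r)) : 0 ≤ permMoment Φ α := by
  obtain ⟨e, f, h⟩ := hΦ
  have h1 : permMoment Φ α = ∑ s : Fin r → ι, ∑ x : Fin r → ι, ∏ i,
      ∑ a, ∑ b, star (f (s i) a) * Φ (ketBra (e (x i)) (e (x (α i)))) a b *
        f (s (finRotate r i)) b := by
    rw [permMoment_eq_sum, Finset.sum_comm]
    rw [Finset.sum_congr rfl fun x _ => (sum_prod_conj_eq (fun c a => f c a) f.sum_star_mul_eq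
      (finRotate r) fun i a b => Φ (Matrix.single (x i) (x (α i)) 1) a b).symm, Finset.sum_comm]
    refine Finset.sum_congr rfl fun s _ => ?_
    -- The input basis enters conjugated, since `ketBra` puts the star on its second vector.
    rw [← sum_prod_conj_eq (fun c a => star (e c a)) (fun a b => ?_) α
      fun i g h => ∑ a, ∑ b, star (f (s i) a) * Φ (Matrix.single g h 1) a b *
        f (s (finRotate r i)) b]
    · refine Finset.sum_congr rfl fun x _ => Finset.prod_congr rfl fun i _ => ?_
      simp_rw [apply_eq_sum_single Φ (ketBra _ _), Finset.mul_sum, Finset.sum_mul]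
      symm
      rw [Finset.sum_comm_cycle]
      refine Finset.sum_congr rfl fun g _ => ?_
      rw [Finset.sum_comm_cycle]
      refine Finset.sum_congr rfl fun h _ => Finset.sum_congr rfl fun a _ =>
        Finset.sum_congr rfl fun b _ => ?_
      rw [ketBra, Matrix.of_apply, star_star]
      ring
    · have := e.sum_star_mul_eq b a
      simp only [star_star]
      rw [if_congr (eq_comm : a = b ↔ b = a) rfl rfl, ← this]
      exact Finset.sum_congr rfl fun c _ => mul_comm _ _
  rw [h1]
  exact Finset.sum_nonneg fun s _ => Finset.sum_nonneg fun x _ =>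
    Finset.prod_nonneg fun i _ => h _ _ _ _

/-! ### Exponential growth rates of power sums -/

section PowerSums

variable {I : Type*} [Fintype I] {q : I → ℂ} {Q : ℝ}

lemma norm_sum_pow_le (hq : ∀ i, ‖q i‖ ≤ Q) (n : ℕ) :
    ‖∑ i, q i ^ n‖ ≤ Fintype.card I * Q ^ n := by
  refine (norm_sum_le _ _).trans ((Finset.sum_le_card_nsmul _ _ (Q ^ n) fun i _ => ?_).trans ?_)
  · rw [norm_pow]
    exact pow_le_pow_left₀ (norm_nonneg _) (hq i) n
  · rw [nsmul_eq_mul, Finset.card_univ]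

lemma tendsto_sum_pow_of_norm_ne (hQ : 0 < Q) (hq : ∀ i, ‖q i‖ ≤ Q) :
    Tendsto (fun n : ℕ => ∑ i with ‖q i‖ ≠ Q, (q i / Q) ^ n) atTop (𝓝 0) := by
  rw [← Finset.sum_const_zero (s := Finset.univ.filter fun i => ‖q i‖ ≠ Q)]
  refine tendsto_finsetSum _ fun i hi => tendsto_pow_atTop_nhds_zero_of_norm_lt_one ?_
  rw [norm_div, Complex.norm_real, Real.norm_of_nonneg hQ.le, div_lt_one hQ]
  exact lt_of_le_of_ne (hq i) (Finset.mem_filter.1 hi).2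

lemma sum_pow_eq_pow_mul (hQ : 0 < Q) (n : ℕ) :
    ∑ i, q i ^ n = (Q : ℂ) ^ n *
      (∑ i with ‖q i‖ = Q, (q i / Q) ^ n + ∑ i with ‖q i‖ ≠ Q, (q i / Q) ^ n) := by
  have hQ' : (Q : ℂ) ≠ 0 := by exact_mod_cast hQ.ne'
  rw [Finset.sum_filter_add_sum_filter_not, Finset.mul_sum]
  refine Finset.sum_congr rfl fun i _ => ?_
  rw [← mul_pow, mul_div_cancel₀ _ hQ']

/-- After division by `Q ^ n` the dominant term has modulus `1` and the rest tends to zero. -/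
lemma eventually_le_norm_sum_pow_of_existsUnique (hQ : 0 < Q) (hq : ∀ i, ‖q i‖ ≤ Q)
    (h : ∃! i, ‖q i‖ = Q) : ∀ᶠ n : ℕ in atTop, 1 / 2 * Q ^ n ≤ ‖∑ i, q i ^ n‖ := by
  obtain ⟨j, hj, hu⟩ := h
  have hs : (Finset.univ.filter fun i => ‖q i‖ = Q) = {j} := by
    ext i
    simp only [Finset.mem_filter, Finset.mem_univ, true_and, Finset.mem_singleton]
    exact ⟨hu i, fun h => h ▸ hj⟩
  have h0 := (tendsto_sum_pow_of_norm_ne hQ hq).norm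
  rw [norm_zero] at h0
  filter_upwards [h0.eventually (gt_mem_nhds (show (0 : ℝ) < 1 / 2 by norm_num))] with n hn
  rw [sum_pow_eq_pow_mul hQ, hs, Finset.sum_singleton, norm_mul, norm_pow, Complex.norm_real,
    Real.norm_of_nonneg hQ.le, mul_comm]
  refine mul_le_mul_of_nonneg_left ?_ (pow_nonneg hQ.le _)
  have h1 : ‖(q j / Q) ^ n‖ = 1 := by
    rw [norm_pow, norm_div, Complex.norm_real, Real.norm_of_nonneg hQ.le, hj, div_self hQ.ne',
      one_pow]
  have h2 := norm_sub_le_norm_add ((q j / Q) ^ n) (∑ i with ‖q i‖ ≠ Q, (q i / Q) ^ n)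
  linarith

/-- Recurrence in a compact torus: the powers of the vector `u` of phases cluster at `1`, where the
dominant terms add up without cancellation. -/
lemma frequently_le_norm_sum_pow (hQ : 0 < Q) (hq : ∀ i, ‖q i‖ ≤ Q)
    (h : ∃ i, ‖q i‖ = Q) : ∃ᶠ n : ℕ in atTop, 1 / 2 * Q ^ n ≤ ‖∑ i, q i ^ n‖ := by
  obtain ⟨j, hj⟩ := h
  -- Subdominant indices get the dummy phase `1`; they are left out of the sums over phases.
  have hu : ∀ i, ∃ u : Circle, ‖q i‖ = Q → (u : ℂ) = q i / Q := fun i => by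
    by_cases hi : ‖q i‖ = Q
    · refine ⟨⟨q i / Q, mem_sphere_zero_iff_norm.2 ?_⟩, fun _ => rfl⟩
      rw [norm_div, Complex.norm_real, Real.norm_of_nonneg hQ.le, hi,
        div_self hQ.ne']
    · exact ⟨1, fun h => absurd h hi⟩
  choose u hu using hu
  have hF : ContinuousAt (fun w : I → Circle => ∑ i with ‖q i‖ = Q, ((w i : ℂ)).re) 1 := by
    refine Continuous.continuousAt ?_
    fun_prop
  -- The sum is the number of dominant terms, at least `1`. The margin `3 / 4` leaves `1 / 2` after
  -- a remainder below `1 / 4`.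
  have hF1 : (3 / 4 : ℝ) < ∑ i with ‖q i‖ = Q, (((1 : I → Circle) i : ℂ)).re := by
    have : 0 < (Finset.univ.filter fun i => ‖q i‖ = Q).card :=
      Finset.card_pos.2 ⟨j, by simpa using hj⟩
    have : (1 : ℝ) ≤ (Finset.univ.filter fun i => ‖q i‖ = Q).card := by exact_mod_cast this
    simp only [Pi.one_apply, Circle.coe_one, Complex.one_re, Finset.sum_const, nsmul_eq_mul,
      mul_one]
    linarith
  have hfr := (mapClusterPt_one_atTop_pow u).frequently (hF.eventually (lt_mem_nhds hF1))
  have h0 := (tendsto_sum_pow_of_norm_ne hQ hq).norm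
  rw [norm_zero] at h0
  have hev := h0.eventually (gt_mem_nhds (show (0 : ℝ) < 1 / 4 by norm_num))
  refine (hfr.and_eventually hev).mono fun n ⟨hn1, hn2⟩ => ?_
  rw [sum_pow_eq_pow_mul hQ, norm_mul, norm_pow, Complex.norm_real,
    Real.norm_of_nonneg hQ.le, mul_comm]
  refine mul_le_mul_of_nonneg_left ?_ (pow_nonneg hQ.le _)
  have h1 : (∑ i with ‖q i‖ = Q, (q i / Q) ^ n).re =
      ∑ i with ‖q i‖ = Q, (((u ^ n) i : Circle) : ℂ).re := by
    rw [Complex.re_sum]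
    refine Finset.sum_congr rfl fun i hi => ?_
    rw [Pi.pow_apply, Circle.coe_pow, hu i (Finset.mem_filter.1 hi).2]
  have h2 := norm_sub_le_norm_add (∑ i with ‖q i‖ = Q, (q i / Q) ^ n)
    (∑ i with ‖q i‖ ≠ Q, (q i / Q) ^ n)
  have h3 := Complex.re_le_norm (∑ i with ‖q i‖ = Q, (q i / Q) ^ n)
  linarith

lemma le_norm_sum_pow_of_nonneg (hq : ∀ i, 0 ≤ q i) (h : ∃ i, ‖q i‖ = Q) (n : ℕ) :
    Q ^ n ≤ ‖∑ i, q i ^ n‖ := by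
  obtain ⟨j, hj⟩ := h
  have h1 : (∑ i, q i ^ n).re = ∑ i, (q i ^ n).re := Complex.re_sum _ _
  have h2 : q j ^ n = ((Q ^ n : ℝ) : ℂ) := by
    rw [← hj, Complex.ofReal_pow, Complex.norm_of_nonneg' (hq j)]
  refine le_trans ?_ (Complex.re_le_norm _)
  rw [h1]
  refine le_trans (le_of_eq ?_) (Finset.single_le_sum
    (fun i _ => (Complex.nonneg_iff.1 (pow_nonneg (hq i) n)).1) (Finset.mem_univ j))
  rw [h2, Complex.ofReal_re]

end PowerSums

/-! ### Logarithmic growth rates -/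

section Rates

variable {W : ℕ → ℝ} {c D K k : ℝ}

lemma tendsto_inv_mul_logb_geometric (c : ℝ) (hK : 0 < K) (hD : 0 < D) :
    Tendsto (fun n : ℕ => 1 / (n : ℝ) * (c * Real.logb 2 (K * D ^ n))) atTop
      (𝓝 (c * Real.logb 2 D)) := by
  have h : Tendsto (fun n : ℕ => 1 / (n : ℝ) * (c * Real.logb 2 K) + c * Real.logb 2 D) atTop
      (𝓝 (0 * (c * Real.logb 2 K) + c * Real.logb 2 D)) :=
    (tendsto_one_div_atTop_nhds_zero_nat.mul_const _).add_const _
  rw [zero_mul, zero_add] at h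
  refine h.congr' ?_
  filter_upwards [eventually_gt_atTop 0] with n hn
  have hn' : (n : ℝ) ≠ 0 := by exact_mod_cast hn.ne'
  rw [Real.logb_mul hK.ne' (pow_pos hD n).ne', Real.logb_pow]
  field_simp

lemma inv_mul_logb_antitone (hc : c ≤ 0) (n : ℕ) {a b : ℝ} (ha : 0 < a) (hab : a ≤ b) :
    1 / (n : ℝ) * (c * Real.logb 2 b) ≤ 1 / (n : ℝ) * (c * Real.logb 2 a) :=
  mul_le_mul_of_nonneg_left
    (mul_le_mul_of_nonpos_left (Real.logb_le_logb_of_le (by norm_num) ha hab) hc) (by positivity)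

lemma tendsto_inv_mul_logb (hc : c ≤ 0) (hK : 0 < K) (hk : 0 < k) (hD : 0 < D)
    (hW : ∀ n, 0 < W n) (hle : ∀ n, W n ≤ K * D ^ n) (hge : ∀ᶠ n in atTop, k * D ^ n ≤ W n) :
    Tendsto (fun n : ℕ => 1 / (n : ℝ) * (c * Real.logb 2 (W n))) atTop
      (𝓝 (c * Real.logb 2 D)) := by
  refine tendsto_of_tendsto_of_tendsto_of_le_of_le' (tendsto_inv_mul_logb_geometric c hK hD)
    (tendsto_inv_mul_logb_geometric c hk hD)
    (Eventually.of_forall fun n => inv_mul_logb_antitone hc n (hW n) (hle n)) ?_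
  filter_upwards [hge] with n hn
  exact inv_mul_logb_antitone hc n (by positivity) hn

/-- Since `c ≤ 0` reverses inequalities, the bound `hle` bounds the liminf from below, and a lower
bound on `W` holding only frequently suffices for the other side. -/
lemma liminf_inv_mul_logb (hc : c ≤ 0) (hK : 0 < K) (hk : 0 < k) (hD : 0 < D)
    (hW : ∀ n, 0 < W n) (hle : ∀ n, W n ≤ K * D ^ n) (hge : ∃ᶠ n in atTop, k * D ^ n ≤ W n) :
    liminf (fun n : ℕ => ((1 / (n : ℝ) * (c * Real.logb 2 (W n)) : ℝ) : EReal)) atTop =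
      ((c * Real.logb 2 D : ℝ) : EReal) := by
  refine le_antisymm (le_of_forall_gt_imp_ge_of_dense fun b hb => ?_) ?_
  · have h := (continuous_coe_real_ereal.tendsto _).comp (tendsto_inv_mul_logb_geometric c hk hD)
    refine liminf_le_of_frequently_le' ((hge.and_eventually (h.eventually (gt_mem_nhds hb))).mono
      fun n hn => ?_)
    exact (EReal.coe_le_coe_iff.2 (inv_mul_logb_antitone hc n (by positivity) hn.1)).trans hn.2.le
  · have h := (continuous_coe_real_ereal.tendsto _).comp (tendsto_inv_mul_logb_geometric c hK hD)
    rw [← h.liminf_eq]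
    exact liminf_le_liminf (Eventually.of_forall fun n =>
      EReal.coe_le_coe_iff.2 (inv_mul_logb_antitone hc n (hW n) (hle n)))

end Rates

/-! ### The regularized quantity -/

lemma avgMoment_channelPow {d : ℕ} (hd : 1 ≤ d)
    {A : Matrix (Fin d) (Fin d) ℂ →ₗ[ℂ] Matrix (Fin d) (Fin d) ℂ} (hA : IsChannel A) {r : ℕ}
    (hr : r ≠ 0) (n : ℕ) :
    0 < avgMoment r (channelPow A n) ∧
    avgMoment r (channelPow A n) = ‖∑ α : Equiv.Perm (Fin r), permMoment A α ^ n‖ /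
      ((d ^ n).ascFactorial r : ℝ) := by
  have : Nonempty (Fin d) := ⟨⟨0, hd⟩⟩
  have hpos := avgMoment_pos (channelPow A n)
    (posSemidef_channelPow_ketBra A hA.posSemidef_choi n)
    (trace_channelPow A hA.tracePreserving n) hr
  refine ⟨hpos, ?_⟩
  have h := congrArg norm (ofReal_avgMoment_eq (channelPow A n)
    (posSemidef_channelPow_ketBra A hA.posSemidef_choi n) hr)
  simp_rw [permMoment_channelPow] at h
  rw [Complex.norm_real, Real.norm_of_nonneg hpos.le, norm_div, Complex.norm_natCast] at h
  simpa using h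

theorem theorem2 (d : ℕ) (hd : 1 ≤ d)
    (A : Matrix (Fin d) (Fin d) ℂ →ₗ[ℂ] Matrix (Fin d) (Fin d) ℂ) (hA : IsChannel A) :
    (∀ r : ℕ, 2 ≤ r →
      betaReg r A =
        ((((r : ℝ) * Real.logb 2 (d : ℝ) - Real.logb 2 (permMomentMax r A)) / ((r : ℝ) - 1) : ℝ) :
          EReal)) ∧
    (∀ r : ℕ, 2 ≤ r →
      (∃! α : Equiv.Perm (Fin r), ‖permMoment A α‖ = permMomentMax r A) →
      Tendsto (fun n : ℕ => (betaSeq r A n : EReal)) atTop (𝓝 (betaReg r A))) ∧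
    (EntrywisePositive A → ∀ r : ℕ, 2 ≤ r →
      Tendsto (fun n : ℕ => (betaSeq r A n : EReal)) atTop (𝓝 (betaReg r A))) := by
  have hd0 : (0 : ℝ) < d := by exact_mod_cast hd
  have hmax : ∀ r (α : Equiv.Perm (Fin r)), ‖permMoment A α‖ ≤ permMomentMax r A :=
    fun r α => Finset.le_sup' (fun α : Equiv.Perm (Fin r) => ‖permMoment A α‖) (Finset.mem_univ α)
  have hatt : ∀ r, ∃ α : Equiv.Perm (Fin r), ‖permMoment A α‖ = permMomentMax r A := fun r => by
    obtain ⟨α, -, h⟩ := Finset.exists_mem_eq_sup' (Finset.univ_nonempty)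
      fun α : Equiv.Perm (Fin r) => ‖permMoment A α‖
    exact ⟨α, h.symm⟩
  -- If the maximum were zero, the average moment at `n = 1` would vanish, contradicting its
  -- positivity.
  have hQ : ∀ r : ℕ, 2 ≤ r → 0 < permMomentMax r A := fun r hr => by
    obtain ⟨h1, h2⟩ := avgMoment_channelPow hd hA (r := r) (by lia) 1
    by_contra! h
    obtain ⟨α, hα⟩ := hatt r
    have h3 : permMomentMax r A = 0 := le_antisymm h (hα ▸ norm_nonneg _)
    have h4 : ∀ α : Equiv.Perm (Fin r), permMoment A α = 0 := fun α =>
      norm_le_zero_iff.1 (h3 ▸ hmax r α)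
    simp [h4] at h2
    exact h1.ne' h2
  -- The denominator is geometric in `n` up to the constant `r!`, so it contributes exactly `d ^ r`
  -- to the rate.
  have hasc : ∀ n r : ℕ, ((d : ℝ) ^ r) ^ n ≤ ((d ^ n).ascFactorial r : ℝ) ∧
      ((d ^ n).ascFactorial r : ℝ) ≤ (r.factorial : ℝ) * ((d : ℝ) ^ r) ^ n := fun n r => by
    have e : ((d : ℝ) ^ r) ^ n = (((d ^ n) ^ r : ℕ) : ℝ) := by push_cast; ring
    rw [e]
    exact ⟨by exact_mod_cast Nat.pow_succ_le_ascFactorial _ _,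
      by exact_mod_cast Nat.ascFactorial_le_factorial_mul_pow _ _⟩
  have hpow : ∀ n r : ℕ, 0 < ((d : ℝ) ^ r) ^ n := fun n r => by positivity
  have hupper : ∀ r : ℕ, 2 ≤ r → ∀ n, avgMoment r (channelPow A n) ≤
      Fintype.card (Equiv.Perm (Fin r)) * (permMomentMax r A / d ^ r) ^ n := fun r hr n => by
    rw [(avgMoment_channelPow hd hA (by lia) n).2, div_pow, ← mul_div_assoc]
    have := (hQ r hr).le
    exact div_le_div₀ (by positivity) (norm_sum_pow_le (hmax r) n) (hpow n r) (hasc n r).1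
  have hlower : ∀ r : ℕ, 2 ≤ r → ∀ n,
      1 / 2 * permMomentMax r A ^ n ≤ ‖∑ α : Equiv.Perm (Fin r), permMoment A α ^ n‖ →
      1 / 2 / (r.factorial : ℝ) * (permMomentMax r A / d ^ r) ^ n ≤
        avgMoment r (channelPow A n) := fun r hr n h => by
    rw [(avgMoment_channelPow hd hA (by lia) n).2, div_pow, div_mul_div_comm]
    exact div_le_div₀ (norm_nonneg _) h ((hpow n r).trans_le (hasc n r).1) (hasc n r).2
  have hK : ∀ r : ℕ, (0 : ℝ) < Fintype.card (Equiv.Perm (Fin r)) := fun r => by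
    exact_mod_cast Fintype.card_pos
  have hk : ∀ r : ℕ, (0 : ℝ) < 1 / 2 / (r.factorial : ℝ) := fun r => by positivity
  have hc : ∀ r : ℕ, 2 ≤ r → 1 / (1 - (r : ℝ)) ≤ 0 := fun r hr => by
    have : (2 : ℝ) ≤ r := by exact_mod_cast hr
    exact one_div_nonpos.2 (by linarith)
  have hD : ∀ r : ℕ, 2 ≤ r → 0 < permMomentMax r A / (d : ℝ) ^ r := fun r hr =>
    div_pos (hQ r hr) (by positivity)
  have hreg : ∀ r : ℕ, 2 ≤ r → betaReg r A =
      ((1 / (1 - (r : ℝ)) * Real.logb 2 (permMomentMax r A / d ^ r) : ℝ) : EReal) := fun r hr =>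
    liminf_inv_mul_logb (hc r hr) (hK r) (hk r) (hD r hr)
      (fun n => (avgMoment_channelPow hd hA (by lia) n).1) (hupper r hr)
      ((frequently_le_norm_sum_pow (hQ r hr) (hmax r) (hatt r)).mono (hlower r hr))
  have hlim : ∀ r : ℕ, 2 ≤ r → (∀ᶠ n : ℕ in atTop,
      1 / 2 * permMomentMax r A ^ n ≤ ‖∑ α : Equiv.Perm (Fin r), permMoment A α ^ n‖) →
      Tendsto (fun n : ℕ => (betaSeq r A n : EReal)) atTop (𝓝 (betaReg r A)) := fun r hr h => by
    rw [hreg r hr]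
    exact (continuous_coe_real_ereal.tendsto _).comp
      (tendsto_inv_mul_logb (hc r hr) (hK r) (hk r) (hD r hr)
        (fun n => (avgMoment_channelPow hd hA (by lia) n).1) (hupper r hr) (h.mono (hlower r hr)))
  refine ⟨fun r hr => ?_, fun r hr h => hlim r hr
    (eventually_le_norm_sum_pow_of_existsUnique (hQ r hr) (hmax r) h), fun hpos r hr => hlim r hr
    (Eventually.of_forall fun n => ?_)⟩
  · rw [hreg r hr, Real.logb_div (hQ r hr).ne' (by positivity), Real.logb_pow]
    have h2 : (2 : ℝ) ≤ r := by exact_mod_cast hr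
    have h3 : 1 - (r : ℝ) ≠ 0 := by linarith
    have h4 : (r : ℝ) - 1 ≠ 0 := by linarith
    congr 1
    field_simp
    ring
  · have h1 := le_norm_sum_pow_of_nonneg (fun α => hpos.permMoment_nonneg α) (hatt r) n
    have h2 := pow_nonneg (hQ r hr).le n
    linarith
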